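/- Notation: inequalities $\preceq,\prec$ between real vectors, absolute values $|\cdot|$ of (real or complex) vectors and matrices, maxima and limits superior are all componentwise; $\prec$ means strict inequality in every component. Let $n\ge 0$, $N\ge 1$, $\bar\tau\ge 0$. For $i=1,\dots,N$ let $A_i\in\mathbb{R}^{n\times n}$, $H_i\in\mathbb{R}^{n\times k_i}$, and let $\delta_i:\mathbb{R}^n_{+0}\to\mathbb{R}^{k_i}_{+0}$ be continuous and monotone ($0\preceq x\preceq y$ implies $\delta_i(x)\preceq\delta_i(y)$), where $\mathbb{R}_{+0}=[0,\infty)$. Consider the switching system $$\dot x(t)=A_{\sigma(t)}x(t)+H_{\sigma(t)}w_{\sigma(t)}(t),\qquad t\ge 0,$$ with an arbitrary switching function $\sigma$ with values in $\{1,\dots,N\}$ and perturbations satisfying $$|w_i(t)|\preceq\delta_i(\theta(t))\quad\text{for all } t\ge 0 \text{ and all } i,\qquad \theta(t)=\max_{t-\bar\tau\le s\le t}|x(s)|.$$ A trajectory is a function $x$, continuous on $[-\bar\tau,\infty)$ and locally absolutely continuous on $[0,\infty)$, that satisfies the differential equation for almost every $t\ge 0$, for some such $\sigma$ and $w_i$.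 Let $V\in\mathbb{C}^{n\times n}$ be invertible. For $M\in\mathbb{C}^{n\times n}$ let $\mathcal{M}(M)$ be the real matrix with diagonal entries $\mathrm{Re}\,M_{jj}$ and off-diagonal entries $|M_{jl}|$, and let $\Lambda=\max_i\mathcal{M}(V^{-1}A_iV)$ (entrywise). Suppose that $\Lambda$ is Hurwitz (all its eigenvalues have negative real part). Let $\delta:\mathbb{R}^n_{+0}\to\mathbb{R}^n_{+0}$ be continuous and monotone with $$\delta(y)\succeq\psi(y):=\max_i\ \max_{w\in\mathbb{R}^{k_i},\,|w|\preceq\delta_i(|V|y)}|V^{-1}H_iw|\qquad\text{for all } y\in\mathbb{R}^n_{+0},$$ and put $T_\gamma(y)=-\Lambda^{-1}\delta(y)+\gamma$ for $\gamma,y\in\mathbb{R}^n_{+0}$. Call a pair $\beta,\gamma\in\mathbb{R}^n_{+0}$ suitable for $\xi\in\mathbb{R}^n_{+0}$ if $$\xi\preceq T_\gamma(\beta)\qquad\text{and}\qquad -\Lambda^{-1}\bigl[\delta(\beta)+\max\{-\Lambda\gamma,0\}\bigr]\prec\beta .$$ Suppose that for every $\xi\in\mathbb{R}^n_{+0}$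 there is a suitable pair. Then for every trajectory $x$, with $\xi=\max_{-\bar\tau\le t\le 0}|V^{-1}x(t)|$, there is a pair suitable for $\xi$; and for every such pair $(\beta,\gamma)$ the limit $\lim_{k\to\infty}T_0^k(\beta)$ exists, the function $|V^{-1}x(t)|$ is bounded as $t\to\infty$, and $$\limsup_{t\to\infty}|V^{-1}x(t)|\preceq\lim_{k\to\infty}T_0^k(\beta).$$ -/

import Mathlib

open MeasureTheory Filter Topology
open scoped Matrix

noncomputable section

namespace Switching

/-- The nonnegative orthant. (For real vectors, `≤` is the componentwise order.) -/
def orthant (n : ℕ) : Set (Fin n → ℝ) := {x | 0 ≤ x}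

/-- Strict componentwise inequality between real vectors (in every component). -/
def SLt {n : ℕ} (x y : Fin n → ℝ) : Prop := ∀ j, x j < y j

/-- Componentwise magnitude of a complex vector. -/
def cabs {n : ℕ} (z : Fin n → ℂ) : Fin n → ℝ := fun j => ‖z j‖

/-- Monotonicity on the nonnegative orthant: `0 ≤ x ≤ y` implies `f x ≤ f y`.
(This is the property called "CNI" in the source.) -/
def CNI {n m : ℕ} (f : (Fin n → ℝ) → Fin m → ℝ) : Prop :=
  ∀ x ∈ orthant n, ∀ y ∈ orthant n, x ≤ y → f x ≤ f y

/-- Componentwise maximum over `s` of a family of real vectors. -/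
def vmax {α : Type*} {n : ℕ} (s : Set α) (f : α → Fin n → ℝ) : Fin n → ℝ :=
  fun j => sSup ((fun a => f a j) '' s)

/-- Complexification of a real matrix. -/
def toC {m n : ℕ} (A : Matrix (Fin m) (Fin n) ℝ) : Matrix (Fin m) (Fin n) ℂ :=
  A.map Complex.ofReal

/-- Complexification of a real vector. -/
def vecC {n : ℕ} (x : Fin n → ℝ) : Fin n → ℂ := fun j => (x j : ℂ)

/-- `|V⁻¹ x|`, componentwise. -/
def coordAbs {n : ℕ} (V : Matrix (Fin n) (Fin n) ℂ) (x : Fin n → ℝ) : Fin n → ℝ :=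
  cabs (V⁻¹ *ᵥ vecC x)

/-- The Metzler matrix of a complex matrix: real parts on the diagonal, magnitudes off it. -/
def metzlerPart {n : ℕ} (M : Matrix (Fin n) (Fin n) ℂ) : Matrix (Fin n) (Fin n) ℝ :=
  Matrix.of fun j l => if j = l then (M j l).re else ‖M j l‖

/-- All (complex) eigenvalues have negative real part. -/
def IsHurwitz {n : ℕ} (L : Matrix (Fin n) (Fin n) ℝ) : Prop :=
  ∀ μ ∈ spectrum ℂ (toC L), μ.re < 0

/-- The data of a switching perturbed system with state dimension `n` and `N` modes: the matrices
`A i`, `H i`, the continuous nonnegative perturbation bounds `δ i`, and the maximum delay `τ`.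
The functions `δ i` matter only on the nonnegative orthant. -/
structure System (n N : ℕ) where
  k : Fin N → ℕ
  A : Fin N → Matrix (Fin n) (Fin n) ℝ
  H : (i : Fin N) → Matrix (Fin n) (Fin (k i)) ℝ
  δ : (i : Fin N) → (Fin n → ℝ) → Fin (k i) → ℝ
  τ : ℝ
  δ_continuousOn : ∀ i, ContinuousOn (δ i) (orthant n)
  δ_nonneg : ∀ i, ∀ x ∈ orthant n, 0 ≤ δ i x
  τ_nonneg : 0 ≤ τ

variable {n N : ℕ}

/-- `θ(t)`, the componentwise maximum of `|x|` over `[t - τ, t]`. -/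
def System.theta (S : System n N) (x : ℝ → Fin n → ℝ) (t : ℝ) : Fin n → ℝ :=
  vmax (Set.Icc (t - S.τ) t) fun s => |x s|

/-- `x` is a trajectory on `[-τ, ∞)` under the switching function `σ` and the perturbations `w`:
`x` is continuous on `[-τ, ∞)`, it is a Carathéodory solution of
`x' = A_σ x + H_σ w_σ` on `[0, ∞)` (locally absolutely continuous, with the equation holding
almost everywhere), and `|w i t| ≤ δ i (θ t)` for all `t ≥ 0` and all `i`. -/
structure System.IsTrajectory (S : System n N) (σ : ℝ → Fin N)
    (w : (i : Fin N) → ℝ → Fin (S.k i) → ℝ) (x : ℝ → Fin n → ℝ) : Prop where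
  continuousOn : ContinuousOn x (Set.Ici (-S.τ))
  absolutelyContinuous : ∀ T : ℝ, 0 ≤ T → AbsolutelyContinuousOnInterval x 0 T
  ode : ∀ᵐ t : ℝ, 0 ≤ t →
    HasDerivAt x (S.A (σ t) *ᵥ x t + S.H (σ t) *ᵥ w (σ t) t) t
  bound : ∀ t : ℝ, 0 ≤ t → ∀ i, |w i t| ≤ S.δ i (S.theta x t)

/-- `Λ`, the entrywise maximum over the modes of the Metzler matrices of `V⁻¹ A_i V`. -/
def System.Lam [NeZero N] (S : System n N) (V : Matrix (Fin n) (Fin n) ℂ) :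
    Matrix (Fin n) (Fin n) ℝ :=
  Matrix.of fun j l => Finset.univ.sup' Finset.univ_nonempty fun i : Fin N =>
    metzlerPart (V⁻¹ * toC (S.A i) * V) j l

/-- `ψ(y) = max_i max_{|w| ≤ δ_i(|V| y)} |V⁻¹ H_i w|`, all maxima componentwise. -/
def System.psi [NeZero N] (S : System n N) (V : Matrix (Fin n) (Fin n) ℂ) (y : Fin n → ℝ) :
    Fin n → ℝ :=
  fun j => Finset.univ.sup' Finset.univ_nonempty fun i : Fin N =>
    vmax {w : Fin (S.k i) → ℝ | |w| ≤ S.δ i (V.map (fun z => ‖z‖) *ᵥ y)}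
      (fun w => coordAbs V (S.H i *ᵥ w)) j

/-- `T_γ(y) = -Λ⁻¹ δ(y) + γ`. -/
def T (L : Matrix (Fin n) (Fin n) ℝ) (d : (Fin n → ℝ) → Fin n → ℝ) (γ y : Fin n → ℝ) :
    Fin n → ℝ :=
  (-L⁻¹) *ᵥ d y + γ

/-- `β, γ ≥ 0` are suitable for `ξ`: `ξ ≤ T_γ(β)` and `-Λ⁻¹ [δ(β) + max {-Λ γ, 0}] ≺ β`. -/
structure Suitable (L : Matrix (Fin n) (Fin n) ℝ) (d : (Fin n → ℝ) → Fin n → ℝ)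
    (ξ β γ : Fin n → ℝ) : Prop where
  β_mem : β ∈ orthant n
  γ_mem : γ ∈ orthant n
  le_T : ξ ≤ T L d γ β
  slt : SLt ((-L⁻¹) *ᵥ (d β + (-(L *ᵥ γ)) ⊔ 0)) β

end Switching

end

/-! Along a trajectory the coordinate magnitudes `q = |V⁻¹ x|` satisfy
`q' ≤ Λ q + δ (max of q over the delay window)` almost everywhere. Since `Λ` is Metzler, linear
differential inequalities `q' ≤ Λ q + c` obey a comparison principle, and since `Λ` is also
Hurwitz, `-Λ⁻¹` is entrywise nonnegative. For a suitable pair, `η = -Λ⁻¹ [δ(β) + max {-Λ γ, 0}]`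
dominates the history, is a constant supersolution as long as `q ≤ β`, and lies strictly below
`β`; hence `q` never reaches `β`. Finally, an eventual bound `q ≤ y` yields
`limsup q ≤ -Λ⁻¹ δ(y) = T₀(y)` by linear comparison, so `ℓ = limsup q` satisfies `ℓ ≤ T₀(ℓ)` by
continuity, and `ℓ ≤ β` gives `ℓ ≤ T₀^k(β)` for all `k` by monotonicity. -/

namespace Switching

section AbsolutelyContinuous

variable {a b : ℝ}

theorem absolutelyContinuousOnInterval_comp_of_lipschitzWith {X Y : Type*} [PseudoMetricSpace X]
    [PseudoMetricSpace Y] {f : ℝ → X} {g : X → Y} {K : NNReal} (hg : LipschitzWith K g)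
    (hf : AbsolutelyContinuousOnInterval f a b) :
    AbsolutelyContinuousOnInterval (fun t => g (f t)) a b := by
  refine squeeze_zero (fun E => Finset.sum_nonneg fun i _ => dist_nonneg) (fun E => ?_)
    (by simpa using Tendsto.const_mul (K : ℝ) hf)
  rw [Finset.mul_sum]
  exact Finset.sum_le_sum fun i _ => hg.dist_le_mul _ _

theorem absolutelyContinuousOnInterval_finset_sum {ι E : Type*} [NormedAddCommGroup E]
    [NormedSpace ℝ E] {f : ι → ℝ → E} (s : Finset ι)
    (h : ∀ i ∈ s, AbsolutelyContinuousOnInterval (f i) a b) :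
    AbsolutelyContinuousOnInterval (fun t => ∑ i ∈ s, f i t) a b := by
  classical
  induction s using Finset.induction_on with
  | empty =>
    simpa using (contDiff_const (c := (0 : E)) (n := 1)).contDiffOn.absolutelyContinuousOnInterval
  | insert i s hi ih =>
    simp only [Finset.sum_insert hi]
    exact (h i (Finset.mem_insert_self i s)).fun_add
      (ih fun j hj => h j (Finset.mem_insert_of_mem hj))

theorem ae_differentiableAt_of_forall_absolutelyContinuousOnInterval {E : Type*}
    [NormedAddCommGroup E] [NormedSpace ℝ E] [FiniteDimensional ℝ E] {f : ℝ → E}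
    (hf : ∀ b, a ≤ b → AbsolutelyContinuousOnInterval f a b) :
    ∀ᵐ t, a ≤ t → DifferentiableAt ℝ f t := by
  have hnat := ae_all_iff.2 fun k : ℕ =>
    (hf (a + k) (by simp)).boundedVariationOn.ae_differentiableAt_of_mem_uIcc
  filter_upwards [hnat] with t ht hat
  obtain ⟨k, hk⟩ := exists_nat_ge (t - a)
  exact ht k (Set.mem_uIcc_of_le hat (by linarith))

theorem le_of_ae_deriv_nonpos {f : ℝ → ℝ} (hab : a ≤ b)
    (hf : AbsolutelyContinuousOnInterval f a b)
    (h : ∀ᵐ t, t ∈ Set.Ioo a b → deriv f t ≤ 0) : f b ≤ f a := by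
  have hint : ∫ t in a..b, deriv f t ≤ 0 := by
    rw [intervalIntegral.integral_of_le hab, integral_Ioc_eq_integral_Ioo]
    exact setIntegral_nonpos_ae measurableSet_Ioo h
  linarith [hf.integral_deriv_eq_sub]

theorem le_mul_exp_of_ae_deriv_le_mul {f : ℝ → ℝ} {K : ℝ} (hab : a ≤ b)
    (hf : AbsolutelyContinuousOnInterval f a b)
    (h : ∀ᵐ t, t ∈ Set.Ioo a b → deriv f t ≤ K * f t) :
    f b ≤ f a * Real.exp (K * (b - a)) := by
  have hexp : AbsolutelyContinuousOnInterval (fun t => Real.exp (-(K * (t - a)))) a b :=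
    ContDiffOn.absolutelyContinuousOnInterval (by fun_prop)
  have hmono : f b * Real.exp (-(K * (b - a))) ≤ f a * Real.exp (-(K * (a - a))) := by
    refine le_of_ae_deriv_nonpos (f := fun t => f t * Real.exp (-(K * (t - a)))) hab
      (hf.fun_mul hexp) ?_
    filter_upwards [h, hf.ae_differentiableAt] with t ht hft hmem
    have hf' := (hft (Set.Ioo_subset_Icc_self.trans Set.Icc_subset_uIcc hmem)).hasDerivAt
    have hexp' : HasDerivAt (fun t => Real.exp (-(K * (t - a))))
        (Real.exp (-(K * (t - a))) * -K) t := by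
      simpa using (((hasDerivAt_id t).sub_const a).const_mul K).neg.exp
    rw [(hf'.fun_mul hexp').deriv]
    linarith [mul_le_mul_of_nonneg_right (ht hmem) (Real.exp_pos (-(K * (t - a)))).le]
  rwa [sub_self, mul_zero, neg_zero, Real.exp_zero, mul_one, Real.exp_neg, ← div_eq_mul_inv,
    div_le_iff₀ (Real.exp_pos _)] at hmono

theorem hasDerivAt_posPart_sq (x : ℝ) : HasDerivAt (fun y : ℝ => y⁺ ^ 2) (2 * x⁺) x := by
  refine hasDerivAt_of_hasDerivAt_of_ne' (f := fun y : ℝ => y⁺ ^ 2) (g := fun y => 2 * y⁺) (x := 0)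
    (fun y hy => ?_) (by fun_prop) (by fun_prop) x
  rcases hy.lt_or_gt with hneg | hpos
  · rw [posPart_of_nonpos hneg.le, mul_zero]
    refine (hasDerivAt_const y (0 : ℝ)).congr_of_eventuallyEq ?_
    filter_upwards [gt_mem_nhds hneg] with z hz
    rw [posPart_of_nonpos hz.le, zero_pow two_ne_zero]
  · rw [posPart_of_nonneg hpos.le]
    refine HasDerivAt.congr_of_eventuallyEq (by simpa using hasDerivAt_pow 2 y) ?_
    filter_upwards [lt_mem_nhds hpos] with z hz
    rw [posPart_of_nonneg hz.le]

end AbsolutelyContinuous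

section Nonneg

variable {m ι : Type*} [Fintype ι] {A B : Matrix m ι ℝ} {x y : ι → ℝ}

theorem mulVec_mono_of_nonneg (hA : ∀ i j, 0 ≤ A i j) : Monotone (A *ᵥ ·) := fun _ _ hxy i =>
  dotProduct_le_dotProduct_of_nonneg_left hxy (hA i)

theorem mulVec_nonneg (hA : ∀ i j, 0 ≤ A i j) (hx : 0 ≤ x) : 0 ≤ A *ᵥ x := fun i =>
  dotProduct_nonneg_of_nonneg (hA i) hx

theorem mulVec_le_mulVec_of_entries_le (hAB : ∀ i j, A i j ≤ B i j) (hx : 0 ≤ x) :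
    A *ᵥ x ≤ B *ᵥ x := fun i =>
  dotProduct_le_dotProduct_of_nonneg_right (hAB i) hx

end Nonneg

section LinearAlgebra

variable {ι : Type*}

theorem exists_pos_le_smul [Finite ι] (x : ι → ℝ) {v : ι → ℝ} (hv : ∀ j, 0 < v j) :
    ∃ C : ℝ, 0 < C ∧ x ≤ C • v := by
  obtain ⟨C, hC, hle⟩ := ((eventually_gt_atTop (0 : ℝ)).and
    (eventually_all.2 fun j => eventually_ge_atTop (x j / v j))).exists
  exact ⟨C, hC, fun j => (div_le_iff₀ (hv j)).1 (hle j)⟩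

variable [Fintype ι] [DecidableEq ι]

theorem isUnit_det_of_zero_notMem_spectrum {R : Type*} [CommRing R] {A : Matrix ι ι R}
    (hA : 0 ∉ spectrum R A) : IsUnit A.det :=
  (Matrix.isUnit_iff_isUnit_det A).1 ((spectrum.zero_notMem_iff R).1 hA)

theorem mulVec_neg_inv_mulVec {R : Type*} [CommRing R] {A : Matrix ι ι R} (hA : IsUnit A.det)
    (y : ι → R) : A *ᵥ (-A⁻¹ *ᵥ y) = -y := by
  rw [Matrix.neg_mulVec, Matrix.mulVec_neg, Matrix.mulVec_mulVec, Matrix.mul_nonsing_inv _ hA,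
    Matrix.one_mulVec]

theorem continuousOn_inv_algebraMap_sub (L : Matrix ι ι ℝ) :
    ContinuousOn (fun s => (algebraMap ℝ (Matrix ι ι ℝ) s - L)⁻¹) (spectrum ℝ L)ᶜ := by
  intro s hs
  have hdet : (algebraMap ℝ (Matrix ι ι ℝ) s - L).det ≠ 0 :=
    ((Matrix.isUnit_iff_isUnit_det _).1 (spectrum.notMem_iff.1 hs)).ne_zero
  have hinv := continuousAt_matrix_inv (algebraMap ℝ (Matrix ι ι ℝ) s - L)
    (by simpa only [Ring.inverse_eq_inv'] using continuousAt_inv₀ hdet)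
  have hsub : Continuous fun s => algebraMap ℝ (Matrix ι ι ℝ) s - L :=
    (continuous_algebraMap ℝ (Matrix ι ι ℝ)).sub continuous_const
  exact (hinv.comp (f := fun s => algebraMap ℝ (Matrix ι ι ℝ) s - L)
    hsub.continuousAt).continuousWithinAt

end LinearAlgebra

/-- Metzler matrices: the off-diagonal entries are nonnegative, so that `x' = M x` preserves the
nonnegative orthant. -/
def IsMetzler {ι : Type*} (M : Matrix ι ι ℝ) : Prop := ∀ j l, j ≠ l → 0 ≤ M j l

namespace IsMetzler

section Comparison

variable {ι : Type*} [Fintype ι] {M : Matrix ι ι ℝ} {a b : ℝ}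

theorem posPart_dotProduct_mulVec_le (hM : IsMetzler M) (x : ι → ℝ) :
    x⁺ ⬝ᵥ M *ᵥ x ≤ (∑ j, ∑ l, |M j l|) * ∑ j, (x j)⁺ ^ 2 := by
  have hsq (j : ι) : (x j)⁺ ^ 2 ≤ ∑ i, (x i)⁺ ^ 2 :=
    Finset.single_le_sum (f := fun i => (x i)⁺ ^ 2) (fun i _ => sq_nonneg _) (Finset.mem_univ j)
  have hterm (j l : ι) : (x j)⁺ * (M j l * x l) ≤ |M j l| * ((x j)⁺ * (x l)⁺) := by
    rcases eq_or_ne j l with rfl | hjl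
    · have hmul : (x j)⁺ * x j = (x j)⁺ * (x j)⁺ := by
        rcases le_total (x j) 0 with h | h
        · simp only [posPart_of_nonpos h, zero_mul]
        · rw [posPart_of_nonneg h]
      rw [mul_left_comm, hmul]
      exact mul_le_mul_of_nonneg_right (le_abs_self _) (mul_self_nonneg _)
    · rw [mul_left_comm, abs_of_nonneg (hM j l hjl)]
      exact mul_le_mul_of_nonneg_left
        (mul_le_mul_of_nonneg_left (le_posPart _) (posPart_nonneg _)) (hM j l hjl)
  generalize ∑ j, (x j)⁺ ^ 2 = Φ at hsq ⊢
  simp only [dotProduct, Matrix.mulVec, Finset.mul_sum, Finset.sum_mul, Pi.posPart_apply]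
  refine Finset.sum_le_sum fun j _ => Finset.sum_le_sum fun l _ => (hterm j l).trans ?_
  exact mul_le_mul_of_nonneg_left
    (by nlinarith [hsq j, hsq l, sq_nonneg ((x j)⁺ - (x l)⁺)]) (abs_nonneg _)

theorem nonpos_of_deriv_le (hM : IsMetzler M) {p : ℝ → ι → ℝ} (hab : a ≤ b)
    (hp : AbsolutelyContinuousOnInterval p a b)
    (hderiv : ∀ᵐ t, t ∈ Set.Ioo a b → deriv p t ≤ M *ᵥ p t) (ha : p a ≤ 0) : p b ≤ 0 := by
  have hposPart (j : ι) : AbsolutelyContinuousOnInterval (fun t => (p t j)⁺) a b :=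
    absolutelyContinuousOnInterval_comp_of_lipschitzWith (g := fun v : ι → ℝ => (v j)⁺)
      (lipschitzWith_posPart.comp (LipschitzWith.eval j)) hp
  have hgronwall := le_mul_exp_of_ae_deriv_le_mul (f := fun t => ∑ j, (p t j)⁺ ^ 2)
    (K := 2 * ∑ j, ∑ l, |M j l|) hab
    (absolutelyContinuousOnInterval_finset_sum _ fun j _ => by
      simpa only [sq] using (hposPart j).fun_mul (hposPart j))
    (by
      filter_upwards [hderiv, hp.boundedVariationOn.ae_differentiableAt_of_mem_uIcc]
        with t hle hdiff hmem
      have hp' := hasDerivAt_pi.1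
        (hdiff (Set.Ioo_subset_Icc_self.trans Set.Icc_subset_uIcc hmem)).hasDerivAt
      have hsum : HasDerivAt (fun t => ∑ j, (p t j)⁺ ^ 2)
          (∑ j, 2 * (p t j)⁺ * deriv p t j) t :=
        HasDerivAt.fun_sum fun j _ =>
          HasDerivAt.comp t (h₂ := fun y : ℝ => y⁺ ^ 2) (hasDerivAt_posPart_sq (p t j)) (hp' j)
      calc deriv (fun t => ∑ j, (p t j)⁺ ^ 2) t = 2 * ((p t)⁺ ⬝ᵥ deriv p t) := by
            simp only [hsum.deriv, dotProduct, Finset.mul_sum, mul_assoc, Pi.posPart_apply]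
        _ ≤ 2 * ((p t)⁺ ⬝ᵥ M *ᵥ p t) := by
            gcongr
            exact dotProduct_le_dotProduct_of_nonneg_left (hle hmem) (posPart_nonneg _)
        _ ≤ _ := by
            rw [mul_assoc]
            gcongr
            exact hM.posPart_dotProduct_mulVec_le (p t))
  have hzero : ∑ j, (p a j)⁺ ^ 2 = 0 :=
    Finset.sum_eq_zero fun j _ => by rw [posPart_of_nonpos (ha j), zero_pow two_ne_zero]
  rw [hzero, zero_mul] at hgronwall
  intro j
  have hj := (Finset.sum_eq_zero_iff_of_nonneg fun j _ => sq_nonneg _).1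
    (hgronwall.antisymm (Finset.sum_nonneg fun j _ => sq_nonneg _)) j (Finset.mem_univ j)
  exact posPart_eq_zero.1 (pow_eq_zero_iff two_ne_zero |>.1 hj)

theorem le_of_deriv_le (hM : IsMetzler M) {q g : ℝ → ι → ℝ} (hab : a ≤ b)
    (hq : AbsolutelyContinuousOnInterval q a b) (hg : AbsolutelyContinuousOnInterval g a b)
    (hderiv : ∀ᵐ t, t ∈ Set.Ioo a b → deriv q t - M *ᵥ q t ≤ deriv g t - M *ᵥ g t)
    (ha : q a ≤ g a) : q b ≤ g b := by
  refine sub_nonpos.1 (hM.nonpos_of_deriv_le (p := fun t => q t - g t) hab (hq.fun_sub hg) ?_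
    (sub_nonpos.2 ha))
  filter_upwards [hderiv, hq.boundedVariationOn.ae_differentiableAt_of_mem_uIcc,
    hg.boundedVariationOn.ae_differentiableAt_of_mem_uIcc] with t hle hq' hg' hmem
  have hmem' : t ∈ Set.uIcc a b := (Set.Ioo_subset_Icc_self.trans Set.Icc_subset_uIcc) hmem
  rw [deriv_fun_sub (hq' hmem') (hg' hmem'), Matrix.mulVec_sub, sub_le_sub_iff]
  have := hle hmem
  rwa [sub_le_sub_iff, add_comm (deriv g t)] at this

end Comparison

section Inverse

variable {ι : Type*} [Fintype ι] {L : Matrix ι ι ℝ} {x y : ι → ℝ}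

theorem row_sum_mul_le_mulVec (hL : IsMetzler L) {j : ι} (hx : ∀ l, x j ≤ x l) :
    (∑ l, L j l) * x j ≤ (L *ᵥ x) j := by
  rw [Matrix.mulVec, dotProduct, Finset.sum_mul]
  refine Finset.sum_le_sum fun l _ => ?_
  rcases eq_or_ne j l with rfl | hjl
  · exact le_rfl
  · exact mul_le_mul_of_nonneg_left (hx l) (hL j l hjl)

variable [DecidableEq ι]

theorem exists_le_mul_inf'_of_mulVec_eq [Nonempty ι] (hL : IsMetzler L) {s : ℝ}
    (hx : (algebraMap ℝ (Matrix ι ι ℝ) s - L) *ᵥ x = y) :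
    ∃ j, y j ≤ (s - ∑ l, L j l) * Finset.univ.inf' Finset.univ_nonempty x := by
  obtain ⟨j, -, hj⟩ := Finset.exists_mem_eq_inf' Finset.univ_nonempty x
  refine ⟨j, ?_⟩
  have hrow := hL.row_sum_mul_le_mulVec fun l => hj ▸ Finset.inf'_le x (Finset.mem_univ l)
  rw [hj, ← hx, Algebra.algebraMap_eq_smul_one, Matrix.sub_mulVec, Matrix.smul_mulVec,
    Matrix.one_mulVec, Pi.sub_apply, Pi.smul_apply, smul_eq_mul, sub_mul]
  exact sub_le_sub_left hrow _

/- By `exists_le_mul_inf'_of_mulVec_eq`, the least component of `(s - L)⁻¹ y` is never zero for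
`s ≥ 0` and is positive for large `s`, so by continuity it is positive at `s = 0`. -/
theorem neg_inv_mulVec_pos (hL : IsMetzler L) (hspec : ∀ s ∈ spectrum ℝ L, s < 0)
    (hy : ∀ j, 0 < y j) (i : ι) : 0 < (-L⁻¹ *ᵥ y) i := by
  have : Nonempty ι := ⟨i⟩
  have hnotMem {s : ℝ} (hs : 0 ≤ s) : s ∉ spectrum ℝ L := fun h => (hspec s h).not_ge hs
  let x (s : ℝ) : ι → ℝ := (algebraMap ℝ (Matrix ι ι ℝ) s - L)⁻¹ *ᵥ y
  let m (s : ℝ) : ℝ := Finset.univ.inf' Finset.univ_nonempty (x s)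
  have hm {s : ℝ} (hs : 0 ≤ s) : ∃ j, y j ≤ (s - ∑ l, L j l) * m s := by
    refine hL.exists_le_mul_inf'_of_mulVec_eq ?_
    have hunit := (Matrix.isUnit_iff_isUnit_det _).1 (spectrum.notMem_iff.1 (hnotMem hs))
    rw [Matrix.mulVec_mulVec, Matrix.mul_nonsing_inv _ hunit, Matrix.one_mulVec]
  have hm_ne {s : ℝ} (hs : 0 ≤ s) : m s ≠ 0 := fun h => by
    obtain ⟨j, hj⟩ := hm hs
    exact (hy j).not_ge (by simpa [h] using hj)
  have hm_cont : ContinuousOn m (Set.Ici 0) :=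
    ContinuousOn.finset_inf'_apply _ fun j _ => (continuous_apply j).comp_continuousOn
      ((continuous_id.matrix_mulVec continuous_const).comp_continuousOn
        ((continuousOn_inv_algebraMap_sub L).mono fun s hs => hnotMem hs))
  obtain ⟨s, hs, hm_pos⟩ : ∃ s, 0 ≤ s ∧ 0 < m s := by
    obtain ⟨s, hs⟩ := ((eventually_ge_atTop 0).and (eventually_all.2 fun j =>
      eventually_gt_atTop (∑ l, L j l))).exists
    obtain ⟨j, hj⟩ := hm hs.1
    exact ⟨s, hs.1, pos_of_mul_pos_right ((hy j).trans_le hj) (sub_pos.2 (hs.2 j)).le⟩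
  have hm_zero : 0 < m 0 := by
    by_contra! hle
    obtain ⟨r, hr, hr_zero⟩ := intermediate_value_Icc hs (hm_cont.mono Set.Icc_subset_Ici_self)
      ⟨hle, hm_pos.le⟩
    exact hm_ne hr.1 hr_zero
  have hx_zero : x 0 = -L⁻¹ *ᵥ y := by
    have hL_det := isUnit_det_of_zero_notMem_spectrum (hnotMem le_rfl)
    have hinv : (-L)⁻¹ = -L⁻¹ :=
      Matrix.inv_eq_left_inv (by rw [neg_mul_neg, Matrix.nonsing_inv_mul _ hL_det])
    simp only [x, map_zero, zero_sub, hinv]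
  exact hx_zero ▸ hm_zero.trans_le (Finset.inf'_le _ (Finset.mem_univ i))

theorem neg_inv_mulVec_nonneg (hL : IsMetzler L) (hspec : ∀ s ∈ spectrum ℝ L, s < 0)
    (hy : 0 ≤ y) : 0 ≤ -L⁻¹ *ᵥ y := by
  have htendsto : Tendsto (fun ε : ℝ => -L⁻¹ *ᵥ (y + ε • 1)) (𝓝[>] 0)
      (𝓝 (-L⁻¹ *ᵥ (y + (0 : ℝ) • 1))) :=
    (Continuous.tendsto (by fun_prop) 0).mono_left nhdsWithin_le_nhds
  rw [zero_smul, add_zero] at htendsto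
  refine ge_of_tendsto htendsto ?_
  filter_upwards [self_mem_nhdsWithin] with ε hε i
  exact (hL.neg_inv_mulVec_pos hspec
    (fun j => add_pos_of_nonneg_of_pos (hy j) (by simpa using hε)) i).le

theorem neg_inv_nonneg (hL : IsMetzler L) (hspec : ∀ s ∈ spectrum ℝ L, s < 0) (i j : ι) :
    0 ≤ (-L⁻¹) i j := by
  simpa using hL.neg_inv_mulVec_nonneg hspec (y := Pi.single j 1)
    (Pi.single_nonneg.2 zero_le_one) i

theorem exists_pos_mulVec_le (hL : IsMetzler L) (hspec : ∀ s ∈ spectrum ℝ L, s < 0) :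
    ∃ v : ι → ℝ, (∀ j, 0 < v j) ∧ ∃ r : ℝ, 0 < r ∧ L *ᵥ v ≤ -(r • v) := by
  have hdet := isUnit_det_of_zero_notMem_spectrum fun h => (hspec 0 h).false
  obtain ⟨C, hC, hle⟩ := exists_pos_le_smul (-L⁻¹ *ᵥ 1) (v := (1 : ι → ℝ)) fun _ => zero_lt_one
  refine ⟨-L⁻¹ *ᵥ 1, hL.neg_inv_mulVec_pos hspec fun _ => zero_lt_one, C⁻¹, inv_pos.2 hC, ?_⟩
  rw [mulVec_neg_inv_mulVec hdet, neg_le_neg_iff]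
  exact (inv_smul_le_iff_of_pos hC).2 hle

/- The bound is `-L⁻¹ c + C e^{-r (t - b)} v` with `v > 0` such that `L v ≤ -r v`. -/
theorem exists_tendsto_forall_le_of_deriv_le (hL : IsMetzler L)
    (hspec : ∀ s ∈ spectrum ℝ L, s < 0) {q : ℝ → ι → ℝ} {c : ι → ℝ} {b : ℝ}
    (hq : ∀ t, b ≤ t → AbsolutelyContinuousOnInterval q b t)
    (hderiv : ∀ᵐ t, b < t → deriv q t ≤ L *ᵥ q t + c) :
    ∃ g : ℝ → ι → ℝ, Tendsto g atTop (𝓝 (-L⁻¹ *ᵥ c)) ∧ ∀ t, b ≤ t → q t ≤ g t := by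
  have hdet := isUnit_det_of_zero_notMem_spectrum fun h => (hspec 0 h).false
  obtain ⟨v, hv, r, hr, hLv⟩ := hL.exists_pos_mulVec_le hspec
  obtain ⟨C, hC, hqb⟩ := exists_pos_le_smul (q b - -L⁻¹ *ᵥ c) hv
  let e (t : ℝ) : ℝ := C * Real.exp (-(r * (t - b)))
  have he : ContDiff ℝ 1 e := by fun_prop
  have he_deriv (t : ℝ) : HasDerivAt e (e t * -r) t := by
    simpa [e, mul_assoc] using ((((hasDerivAt_id t).sub_const b).const_mul r).neg.exp).const_mul C
  have he_lim : Tendsto e atTop (𝓝 0) := by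
    simpa [e, sub_eq_add_neg] using (Real.tendsto_exp_neg_atTop_nhds_zero.comp
      ((tendsto_atTop_add_const_right _ (-b) tendsto_id).const_mul_atTop hr)).const_mul C
  refine ⟨fun t => -L⁻¹ *ᵥ c + e t • v, ?_, fun t hbt => hL.le_of_deriv_le hbt (hq t hbt)
    ((contDiff_const.add (he.smul contDiff_const)).contDiffOn.absolutelyContinuousOnInterval)
    ?_ ?_⟩
  · simpa using (he_lim.smul_const v).const_add (-L⁻¹ *ᵥ c)
  · filter_upwards [hderiv] with s hs hmem
    have hg := (((he_deriv s).smul_const v).const_add (-L⁻¹ *ᵥ c)).deriv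
    have hsource : c ≤ (e s * -r) • v - L *ᵥ (-L⁻¹ *ᵥ c + e s • v) := by
      have hdecay : e s • L *ᵥ v ≤ e s • -(r • v) :=
        smul_le_smul_of_nonneg_left hLv (by positivity)
      rw [Matrix.mulVec_add, mulVec_neg_inv_mulVec hdet, Matrix.mulVec_smul, mul_smul, neg_smul,
        ← sub_sub, sub_neg_eq_add, add_sub_right_comm]
      exact le_add_of_nonneg_left (sub_nonneg.2 hdecay)
    exact (sub_le_iff_le_add'.2 (hs hmem.1)).trans (hg ▸ hsource)
  · simpa [e] using sub_le_iff_le_add'.1 hqb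

end Inverse

end IsMetzler

section MonotoneIteration

variable {α : Type*} [Preorder α] {f : α → α} {s : Set α} {x y : α}

theorem antitone_iterate_of_monotoneOn (hf : MonotoneOn f s) (hs : Set.MapsTo f s s) (hx : x ∈ s)
    (hfx : f x ≤ x) : Antitone fun k => f^[k] x := by
  have hmono : Monotone (hs.restrict f s s) := fun y z hyz => hf y.2 z.2 hyz
  have hanti := hmono.antitone_iterate_of_map_le (x := ⟨x, hx⟩) hfx
  simp only [hs.iterate_restrict] at hanti
  exact fun k l hkl => hanti hkl

theorem le_iterate_of_monotoneOn (hf : MonotoneOn f s) (hs : Set.MapsTo f s s) (hx : x ∈ s)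
    (hfx : x ≤ f x) (hy : y ∈ s) (hxy : x ≤ y) (k : ℕ) : x ≤ f^[k] y := by
  induction k with
  | zero => exact hxy
  | succ k ih =>
    rw [Function.iterate_succ_apply']
    exact hfx.trans (hf hx (hs.iterate k hy) ih)

end MonotoneIteration

section SmallGain

variable {n : ℕ} {L : Matrix (Fin n) (Fin n) ℝ} {d : (Fin n → ℝ) → Fin n → ℝ}
  {ξ β γ : Fin n → ℝ}

theorem IsHurwitz.neg_of_mem_spectrum (hL : IsHurwitz L) {s : ℝ} (hs : s ∈ spectrum ℝ L) :
    s < 0 := by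
  have hroot : (s : ℂ) ∈ spectrum ℂ (toC L) := by
    rw [Matrix.mem_spectrum_iff_isRoot_charpoly] at hs ⊢
    exact (Matrix.charpoly_map L Complex.ofRealHom).symm ▸ hs.map (f := Complex.ofRealHom)
  exact hL _ hroot

theorem mapsTo_T_zero (hL : ∀ i j, 0 ≤ (-L⁻¹) i j) (hd : ∀ y ∈ orthant n, 0 ≤ d y) :
    Set.MapsTo (T L d 0) (orthant n) (orthant n) := fun y hy =>
  add_nonneg (mulVec_nonneg hL (hd y hy)) le_rfl

theorem monotoneOn_T_zero (hL : ∀ i j, 0 ≤ (-L⁻¹) i j) (hd : CNI d) :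
    MonotoneOn (T L d 0) (orthant n) := fun y hy z hz hyz =>
  add_le_add_left (mulVec_mono_of_nonneg hL (hd y hy z hz hyz)) 0

theorem continuousOn_T_zero (hd : ContinuousOn d (orthant n)) :
    ContinuousOn (T L d 0) (orthant n) :=
  ((continuous_const.matrix_mulVec continuous_id).comp_continuousOn hd).add continuousOn_const

theorem Suitable.T_zero_le (h : Suitable L d ξ β γ) (hL : ∀ i j, 0 ≤ (-L⁻¹) i j) :
    T L d 0 β ≤ β :=
  calc T L d 0 β = -L⁻¹ *ᵥ d β := add_zero _
    _ ≤ -L⁻¹ *ᵥ (d β + (-(L *ᵥ γ)) ⊔ 0) :=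
      mulVec_mono_of_nonneg hL (le_add_of_nonneg_right le_sup_right)
    _ ≤ β := fun j => (h.slt j).le

theorem Suitable.le_supersolution (h : Suitable L d ξ β γ) (hL : ∀ i j, 0 ≤ (-L⁻¹) i j)
    (hdet : IsUnit L.det) : ξ ≤ -L⁻¹ *ᵥ (d β + (-(L *ᵥ γ)) ⊔ 0) :=
  calc ξ ≤ -L⁻¹ *ᵥ d β + γ := h.le_T
    _ = -L⁻¹ *ᵥ (d β + -(L *ᵥ γ)) := by
      rw [Matrix.mulVec_add, Matrix.mulVec_neg, Matrix.mulVec_mulVec, neg_mul,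
        Matrix.nonsing_inv_mul _ hdet, Matrix.neg_mulVec γ, Matrix.one_mulVec, neg_neg]
    _ ≤ _ := mulVec_mono_of_nonneg hL (add_le_add_right le_sup_left _)

theorem exists_tendsto_iterate_T_zero (hL : ∀ i j, 0 ≤ (-L⁻¹) i j)
    (hd_nonneg : ∀ y ∈ orthant n, 0 ≤ d y) (hd : CNI d) (hβ : β ∈ orthant n)
    (hTβ : T L d 0 β ≤ β) : ∃ b, Tendsto (fun k => (T L d 0)^[k] β) atTop (𝓝 b) := by
  have hmaps := mapsTo_T_zero hL hd_nonneg
  refine ⟨_, tendsto_atTop_ciInf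
    (antitone_iterate_of_monotoneOn (monotoneOn_T_zero hL hd) hmaps hβ hTβ) ⟨0, ?_⟩⟩
  rintro _ ⟨k, rfl⟩
  exact hmaps.iterate k hβ

end SmallGain

/-- Nonnegative subsolutions of the comparison system
`q'(t) = L q(t) + d (max_{t - τ ≤ s ≤ t} q(s))`, `t ≥ 0`. For a monotone `d`, having the
inequality for the maximum over the delay window amounts to having it for every `y` above `q` on
the window; the latter form needs neither the maximum to exist nor `d` to be monotone. -/
structure IsDelaySubsolution {n : ℕ} (L : Matrix (Fin n) (Fin n) ℝ)
    (d : (Fin n → ℝ) → Fin n → ℝ) (τ : ℝ) (q : ℝ → Fin n → ℝ) : Prop where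
  nonneg : ∀ t, 0 ≤ q t
  absolutelyContinuous : ∀ t, 0 ≤ t → AbsolutelyContinuousOnInterval q 0 t
  deriv_le : ∀ᵐ t : ℝ, 0 ≤ t → ∀ y, (∀ s ∈ Set.Icc (t - τ) t, q s ≤ y) →
    deriv q t ≤ L *ᵥ q t + d y

namespace IsDelaySubsolution

variable {n : ℕ} {L : Matrix (Fin n) (Fin n) ℝ} {d : (Fin n → ℝ) → Fin n → ℝ} {τ : ℝ}
  {q : ℝ → Fin n → ℝ} {ξ β γ η y : Fin n → ℝ}

theorem continuousOn (h : IsDelaySubsolution L d τ q) : ContinuousOn q (Set.Ici 0) := by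
  intro t ht
  have hcont := (h.absolutelyContinuous (t + 1) (by linarith [Set.mem_Ici.1 ht])).continuousOn
  rw [Set.uIcc_of_le (by linarith [Set.mem_Ici.1 ht])] at hcont
  refine (hcont t ⟨ht, by linarith⟩).mono_of_mem_nhdsWithin ?_
  filter_upwards [self_mem_nhdsWithin, mem_nhdsWithin_of_mem_nhds (gt_mem_nhds (lt_add_one t))]
    with s hs hst using ⟨hs, hst.le⟩

theorem le_of_forall_lt_le (h : IsDelaySubsolution L d τ q) (hL : IsMetzler L)
    (hη : L *ᵥ η + d β ≤ 0) (hq : q 0 ≤ η) {t : ℝ} (ht : 0 ≤ t)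
    (hβ : ∀ s, -τ ≤ s → s < t → q s ≤ β) : q t ≤ η := by
  refine hL.le_of_deriv_le (g := fun _ => η) ht (h.absolutelyContinuous t ht)
    contDiff_const.contDiffOn.absolutelyContinuousOnInterval ?_ hq
  filter_upwards [h.deriv_le] with s hs hmem
  have hwindow := hs hmem.1.le β fun r hr =>
    hβ r (by linarith [hr.1, hmem.1]) (hr.2.trans_lt hmem.2)
  rw [deriv_const, zero_sub]
  exact (sub_le_iff_le_add'.2 hwindow).trans (le_neg_iff_add_nonpos_left.2 hη)

theorem le_of_supersolution (h : IsDelaySubsolution L d τ q) (hτ : 0 ≤ τ) (hL : IsMetzler L)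
    (hη : L *ᵥ η + d β ≤ 0) (hηβ : SLt η β) (hq : ∀ t ∈ Set.Icc (-τ) 0, q t ≤ η) {t : ℝ}
    (ht : 0 ≤ t) : q t ≤ β := by
  let exits : Set ℝ := ⋃ j, Set.Ici 0 ∩ {t | β j ≤ q t j}
  have hclosed : IsClosed exits := isClosed_iUnion_of_finite fun j =>
    ((continuous_apply j).comp_continuousOn h.continuousOn).preimage_isClosed_of_isClosed
      isClosed_Ici isClosed_Ici
  have hbdd : BddBelow exits := ⟨0, fun t ht => (Set.mem_iUnion.1 ht).choose_spec.1⟩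
  have hle_of_notMem {t : ℝ} (ht : -τ ≤ t) (hexit : t ∉ exits) : q t ≤ β := fun j => by
    rcases le_total 0 t with ht0 | ht0
    · exact le_of_not_ge fun hj => hexit (Set.mem_iUnion.2 ⟨j, ht0, hj⟩)
    · exact (hq t ⟨ht, ht0⟩ j).trans (hηβ j).le
  suffices hempty : ¬ exits.Nonempty from
    hle_of_notMem ((neg_nonpos.2 hτ).trans ht) fun hexit => hempty ⟨t, hexit⟩
  intro hne
  obtain ⟨j, hfirst, hj⟩ := Set.mem_iUnion.1 (hclosed.csInf_mem hne hbdd)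
  have hle := h.le_of_forall_lt_le hL hη (hq 0 ⟨neg_nonpos.2 hτ, le_rfl⟩) hfirst
    fun s hs hlt => hle_of_notMem hs fun hexit => (csInf_le hbdd hexit).not_gt hlt
  exact (hηβ j).not_ge (le_trans hj (hle j))

theorem isBoundedUnder_ge (h : IsDelaySubsolution L d τ q) (j : Fin n) :
    IsBoundedUnder (· ≥ ·) atTop fun t => q t j :=
  isBoundedUnder_of ⟨0, fun t => h.nonneg t j⟩

theorem limsup_le_T_zero_of_eventually_le (h : IsDelaySubsolution L d τ q) (hL : IsMetzler L)
    (hspec : ∀ s ∈ spectrum ℝ L, s < 0) (hy : ∀ᶠ t in atTop, q t ≤ y) :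
    (fun j => limsup (fun t => q t j) atTop) ≤ T L d 0 y := by
  obtain ⟨a, ha⟩ := eventually_atTop.1 hy
  obtain ⟨b, hb, hab⟩ := ((eventually_ge_atTop 0).and (eventually_ge_atTop (a + τ))).exists
  obtain ⟨g, hg_lim, hg⟩ := hL.exists_tendsto_forall_le_of_deriv_le hspec (q := q) (c := d y)
    (b := b) (fun t hbt => (h.absolutelyContinuous t (hb.trans hbt)).mono
      (Set.uIcc_subset_uIcc (Set.mem_uIcc_of_le hb hbt) Set.right_mem_uIcc))
    (by
      filter_upwards [h.deriv_le] with t ht hbt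
      exact ht (hb.trans hbt.le) y fun s hs => ha s (by linarith [hs.1]))
  intro j
  have hgj := tendsto_pi_nhds.1 hg_lim j
  calc limsup (fun t => q t j) atTop ≤ limsup (fun t => g t j) atTop :=
        limsup_le_limsup ((eventually_ge_atTop b).mono fun t hbt => hg t hbt j)
          (h.isBoundedUnder_ge j).isCoboundedUnder_le hgj.isBoundedUnder_le
    _ = (-L⁻¹ *ᵥ d y) j := hgj.limsup_eq
    _ = T L d 0 y j := by rw [T, add_zero]

theorem limsup_mem_orthant (h : IsDelaySubsolution L d τ q) (hβ : ∀ᶠ t in atTop, q t ≤ β) :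
    (fun j => limsup (fun t => q t j) atTop) ∈ orthant n := fun j =>
  le_limsup_of_frequently_le (Frequently.of_forall fun t => h.nonneg t j)
    (isBoundedUnder_of_eventually_le (hβ.mono fun _ ht => ht j))

theorem limsup_le_T_zero_limsup (h : IsDelaySubsolution L d τ q) (hL : IsMetzler L)
    (hspec : ∀ s ∈ spectrum ℝ L, s < 0) (hd : ContinuousOn d (orthant n))
    (hβ : ∀ᶠ t in atTop, q t ≤ β) :
    (fun j => limsup (fun t => q t j) atTop) ≤
      T L d 0 fun j => limsup (fun t => q t j) atTop := by
  have hlim := h.limsup_mem_orthant hβ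
  set ℓ : Fin n → ℝ := fun j => limsup (fun t => q t j) atTop
  have hperturb : Tendsto (fun ε : ℝ => ℓ + ε • 1) (𝓝[>] 0) (𝓝[orthant n] ℓ) := by
    refine tendsto_nhdsWithin_iff.2 ⟨?_, ?_⟩
    · have hcont : Continuous fun ε : ℝ => ℓ + ε • (1 : Fin n → ℝ) := by fun_prop
      simpa using (hcont.tendsto 0).mono_left nhdsWithin_le_nhds
    · filter_upwards [self_mem_nhdsWithin] with ε hε
      exact add_nonneg (show 0 ≤ ℓ from hlim) (smul_nonneg (Set.mem_Ioi.1 hε).le zero_le_one)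
  refine ge_of_tendsto ((continuousOn_T_zero hd ℓ hlim).tendsto.comp hperturb) ?_
  filter_upwards [self_mem_nhdsWithin] with ε hε
  refine h.limsup_le_T_zero_of_eventually_le hL hspec (eventually_all.2 fun j => ?_)
  refine (eventually_lt_of_limsup_lt (b := ℓ j + ε) (lt_add_of_pos_right _ hε)
    (isBoundedUnder_of_eventually_le (hβ.mono fun _ ht => ht j))).mono fun t ht => ?_
  simpa using ht.le

theorem limsup_le_of_suitable (h : IsDelaySubsolution L d τ q) (hτ : 0 ≤ τ) (hL : IsMetzler L)
    (hspec : ∀ s ∈ spectrum ℝ L, s < 0) (hd_cont : ContinuousOn d (orthant n))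
    (hd_nonneg : ∀ y ∈ orthant n, 0 ≤ d y) (hd_cni : CNI d) (hβγ : Suitable L d ξ β γ)
    (hξ : ∀ t ∈ Set.Icc (-τ) 0, q t ≤ ξ) :
    ∃ b : Fin n → ℝ, Tendsto (fun k => (T L d 0)^[k] β) atTop (𝓝 b) ∧
      ∀ j, IsBoundedUnder (· ≤ ·) atTop (fun t => q t j) ∧
        limsup (fun t => q t j) atTop ≤ b j := by
  have hinv := hL.neg_inv_nonneg hspec
  have hdet := isUnit_det_of_zero_notMem_spectrum fun h0 => (hspec 0 h0).false
  obtain ⟨b, hb⟩ :=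
    exists_tendsto_iterate_T_zero hinv hd_nonneg hd_cni hβγ.β_mem (hβγ.T_zero_le hinv)
  have hsuper : L *ᵥ (-L⁻¹ *ᵥ (d β + (-(L *ᵥ γ)) ⊔ 0)) + d β ≤ 0 := by
    rw [mulVec_neg_inv_mulVec hdet, neg_add_rev, neg_add_cancel_right]
    exact neg_nonpos.2 le_sup_right
  have hq_le {t : ℝ} (ht : 0 ≤ t) : q t ≤ β := h.le_of_supersolution hτ hL hsuper hβγ.slt
    (fun s hs => (hξ s hs).trans (hβγ.le_supersolution hinv hdet)) ht
  have hβ : ∀ᶠ t in atTop, q t ≤ β := (eventually_ge_atTop 0).mono fun _ => hq_le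
  have hbdd (j : Fin n) : IsBoundedUnder (· ≤ ·) atTop fun t => q t j :=
    isBoundedUnder_of_eventually_le (hβ.mono fun _ ht => ht j)
  have hlim_le_β : (fun j => limsup (fun t => q t j) atTop) ≤ β := fun j =>
    limsup_le_of_le (h.isBoundedUnder_ge j).isCoboundedUnder_le (hβ.mono fun _ ht => ht j)
  have hlim_le_b : (fun j => limsup (fun t => q t j) atTop) ≤ b :=
    ge_of_tendsto' hb (le_iterate_of_monotoneOn (monotoneOn_T_zero hinv hd_cni)
      (mapsTo_T_zero hinv hd_nonneg) (h.limsup_mem_orthant hβ)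
      (h.limsup_le_T_zero_limsup hL hspec hd_cont hβ) hβγ.β_mem hlim_le_β)
  exact ⟨b, hb, fun j => ⟨hbdd j, hlim_le_b j⟩⟩

end IsDelaySubsolution

section Vmax

variable {α : Type*} {n : ℕ} {s : Set α} {f : α → Fin n → ℝ}

theorem le_vmax {a : α} {j : Fin n} (hbdd : BddAbove ((fun a => f a j) '' s)) (ha : a ∈ s) :
    f a j ≤ vmax s f j :=
  le_csSup hbdd (Set.mem_image_of_mem _ ha)

theorem vmax_le {c : Fin n → ℝ} (hs : s.Nonempty) (hf : ∀ a ∈ s, f a ≤ c) : vmax s f ≤ c :=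
  fun j => csSup_le (hs.image _) (Set.forall_mem_image.2 fun a ha => hf a ha j)

theorem vmax_nonneg (hf : ∀ a ∈ s, 0 ≤ f a) : 0 ≤ vmax s f := fun j =>
  Real.sSup_nonneg (Set.forall_mem_image.2 fun a ha => hf a ha j)

end Vmax

section Coordinates

variable {m n : ℕ} {V : Matrix (Fin n) (Fin n) ℂ}

/-- The real-linear coordinate change `x ↦ V⁻¹ x`, so that `|V⁻¹ x| = cabs (coord V x)`; it is
bundled as a continuous linear map in order to differentiate along trajectories. -/
noncomputable def coord (V : Matrix (Fin n) (Fin n) ℂ) : (Fin n → ℝ) →L[ℝ] Fin n → ℂ :=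
  LinearMap.toContinuousLinearMap
    ((V⁻¹).mulVecLin.restrictScalars ℝ ∘ₗ Complex.ofRealAm.toLinearMap.compLeft _)

theorem coord_apply (V : Matrix (Fin n) (Fin n) ℂ) (x : Fin n → ℝ) :
    coord V x = V⁻¹ *ᵥ vecC x := rfl

theorem vecC_mulVec (A : Matrix (Fin m) (Fin n) ℝ) (x : Fin n → ℝ) :
    vecC (A *ᵥ x) = toC A *ᵥ vecC x :=
  RingHom.map_mulVec Complex.ofRealHom A x |> funext

theorem mulVec_coord (hV : IsUnit V.det) (x : Fin n → ℝ) : V *ᵥ coord V x = vecC x := by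
  rw [coord_apply, Matrix.mulVec_mulVec, Matrix.mul_nonsing_inv _ hV, Matrix.one_mulVec]

theorem coord_mulVec (hV : IsUnit V.det) (A : Matrix (Fin n) (Fin n) ℝ) (x : Fin n → ℝ) :
    coord V (A *ᵥ x) = (V⁻¹ * toC A * V) *ᵥ coord V x := by
  rw [coord_apply, vecC_mulVec, ← Matrix.mulVec_mulVec, mulVec_coord hV, Matrix.mulVec_mulVec]

theorem cabs_nonneg (z : Fin n → ℂ) : 0 ≤ cabs z := fun _ => norm_nonneg _

theorem lipschitzWith_cabs : LipschitzWith 1 (cabs : (Fin n → ℂ) → Fin n → ℝ) :=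
  LipschitzWith.mk_one fun z z' => (dist_pi_le_iff dist_nonneg).2 fun j =>
    (dist_norm_norm_le (z j) (z' j)).trans_eq (dist_eq_norm _ _).symm |>.trans
      (dist_le_pi_dist z z' j)

theorem lipschitzWith_coordAbs (V : Matrix (Fin n) (Fin n) ℂ) :
    LipschitzWith ‖coord V‖₊ (coordAbs V) := by
  simpa using! lipschitzWith_cabs.comp (coord V).lipschitz

theorem cabs_mulVec_le (A : Matrix (Fin m) (Fin n) ℂ) (z : Fin n → ℂ) :
    cabs (A *ᵥ z) ≤ A.map (fun a => ‖a‖) *ᵥ cabs z := fun j =>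
  calc ‖∑ l, A j l * z l‖ ≤ ∑ l, ‖A j l * z l‖ := norm_sum_le _ _
    _ = ∑ l, ‖A j l‖ * ‖z l‖ := Finset.sum_congr rfl fun _ _ => norm_mul _ _

theorem abs_le_mulVec_coordAbs (hV : IsUnit V.det) (x : Fin n → ℝ) :
    |x| ≤ V.map (fun z => ‖z‖) *ᵥ coordAbs V x :=
  calc |x| = cabs (V *ᵥ coord V x) := by
        ext j
        rw [mulVec_coord hV, cabs, vecC, Complex.norm_real, Real.norm_eq_abs, Pi.abs_apply]
    _ ≤ _ := cabs_mulVec_le V (coord V x)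

end Coordinates

section ModulusDerivative

variable {n : ℕ} {M : Matrix (Fin n) (Fin n) ℂ} {t : ℝ}

theorem deriv_norm_le_of_inner_le {E : Type*} [NormedAddCommGroup E] [InnerProductSpace ℝ E]
    {z : ℝ → E} {z' : E} {c : ℝ} (hz : HasDerivAt z z' t) (hc : z t = 0 → 0 ≤ c)
    (hinner : inner ℝ (z t) z' ≤ c * ‖z t‖) : deriv (fun s => ‖z s‖) t ≤ c := by
  rcases eq_or_ne (z t) 0 with h0 | h0
  · have hmin : IsLocalMin (fun s => ‖z s‖) t := Eventually.of_forall fun s => by simp [h0]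
    exact hmin.deriv_eq_zero ▸ hc h0
  · have hnorm := hz.norm_sq.sqrt (pow_ne_zero 2 (norm_ne_zero_iff.2 h0))
    simp only [Real.sqrt_sq (norm_nonneg _)] at hnorm
    rwa [hnorm.deriv, mul_div_mul_left _ _ two_ne_zero, div_le_iff₀ (norm_pos_iff.2 h0)]

theorem inner_mulVec_le_metzlerPart (M : Matrix (Fin n) (Fin n) ℂ) (z : Fin n → ℂ) (j : Fin n) :
    inner ℝ (z j) ((M *ᵥ z) j) ≤ (metzlerPart M *ᵥ cabs z) j * ‖z j‖ := by
  have hterm (l : Fin n) : inner ℝ (z j) (M j l * z l) ≤ metzlerPart M j l * ‖z l‖ * ‖z j‖ := by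
    rcases eq_or_ne j l with rfl | hjl
    · rw [metzlerPart, Matrix.of_apply, if_pos rfl, Complex.inner, mul_assoc (M j j).re, ← sq,
        ← Complex.normSq_eq_norm_sq, mul_assoc, Complex.mul_conj, Complex.re_mul_ofReal]
    · rw [metzlerPart, Matrix.of_apply, if_neg hjl, ← norm_mul, mul_comm ‖M j l * z l‖]
      exact real_inner_le_norm (z j) _
  simp only [Matrix.mulVec, dotProduct, inner_sum, Finset.sum_mul]
  exact Finset.sum_le_sum fun l _ => hterm l

theorem isMetzler_metzlerPart (M : Matrix (Fin n) (Fin n) ℂ) : IsMetzler (metzlerPart M) :=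
  fun j l hjl => by
    rw [metzlerPart, Matrix.of_apply, if_neg hjl]
    exact norm_nonneg _

theorem deriv_cabs_le_metzlerPart {z : ℝ → Fin n → ℂ} {u : Fin n → ℂ}
    (hz : HasDerivAt z (M *ᵥ z t + u) t)
    (hdiff : DifferentiableAt ℝ (fun s => cabs (z s)) t) :
    deriv (fun s => cabs (z s)) t ≤ metzlerPart M *ᵥ cabs (z t) + cabs u := by
  intro j
  rw [← (hasDerivAt_pi.1 hdiff.hasDerivAt j).deriv]
  refine deriv_norm_le_of_inner_le (hasDerivAt_pi.1 hz j) (fun hzero => ?_) ?_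
  · refine add_nonneg (show 0 ≤ ∑ l, metzlerPart M j l * cabs (z t) l from
      Finset.sum_nonneg fun l _ => ?_) (norm_nonneg _)
    rcases eq_or_ne j l with rfl | hjl
    · simp [cabs, hzero]
    · exact mul_nonneg (isMetzler_metzlerPart M j l hjl) (norm_nonneg _)
  · rw [Pi.add_apply, Pi.add_apply, inner_add_right, add_mul]
    refine add_le_add (inner_mulVec_le_metzlerPart M (z t) j) ?_
    exact (real_inner_le_norm _ _).trans_eq (mul_comm _ _)

end ModulusDerivative

namespace System

variable {n N : ℕ} [NeZero N] (S : System n N) (V : Matrix (Fin n) (Fin n) ℂ)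

theorem metzlerPart_le_lam (i : Fin N) (j l : Fin n) :
    metzlerPart (V⁻¹ * toC (S.A i) * V) j l ≤ S.Lam V j l :=
  Finset.le_sup' (fun i : Fin N => metzlerPart (V⁻¹ * toC (S.A i) * V) j l) (Finset.mem_univ i)

theorem isMetzler_lam : IsMetzler (S.Lam V) := fun j l hjl =>
  (isMetzler_metzlerPart _ j l hjl).trans (S.metzlerPart_le_lam V 0 j l)

theorem coordAbs_le_psi {y : Fin n → ℝ} {i : Fin N} {w : Fin (S.k i) → ℝ}
    (hw : |w| ≤ S.δ i (V.map (fun z => ‖z‖) *ᵥ y)) : coordAbs V (S.H i *ᵥ w) ≤ S.psi V y := by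
  intro j
  refine le_trans (le_vmax (f := fun w => coordAbs V (S.H i *ᵥ w)) ?_ hw)
    (Finset.le_sup' (fun i : Fin N => vmax {w | |w| ≤ S.δ i (V.map (fun z => ‖z‖) *ᵥ y)}
      (fun w => coordAbs V (S.H i *ᵥ w)) j) (Finset.mem_univ i))
  have hcont : Continuous fun w => coordAbs V (S.H i *ᵥ w) j :=
    (continuous_apply j).comp ((lipschitzWith_coordAbs V).continuous.comp
      (continuous_const.matrix_mulVec continuous_id))
  have hIcc : {w | |w| ≤ S.δ i (V.map (fun z => ‖z‖) *ᵥ y)} =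
      Set.Icc (-S.δ i (V.map (fun z => ‖z‖) *ᵥ y)) (S.δ i (V.map (fun z => ‖z‖) *ᵥ y)) :=
    Set.ext fun v => show |v| ≤ _ ↔ _ from abs_le'.trans (and_comm.trans (and_congr_left' neg_le))
  exact hIcc ▸ isCompact_Icc.bddAbove_image hcont.continuousOn

theorem psi_nonneg (y : Fin n → ℝ) : 0 ≤ S.psi V y := fun j =>
  (vmax_nonneg (fun _ _ => cabs_nonneg _) j).trans
    (Finset.le_sup' (fun i : Fin N => vmax {w | |w| ≤ S.δ i (V.map (fun z => ‖z‖) *ᵥ y)}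
      (fun w => coordAbs V (S.H i *ᵥ w)) j) (Finset.mem_univ 0))

end System

namespace System

variable {n N : ℕ} {S : System n N} {V : Matrix (Fin n) (Fin n) ℂ}

theorem theta_nonneg (S : System n N) (x : ℝ → Fin n → ℝ) (t : ℝ) : 0 ≤ S.theta x t :=
  vmax_nonneg fun s _ => abs_nonneg (x s)

theorem theta_le_mulVec (hV : IsUnit V.det) {x : ℝ → Fin n → ℝ} {t : ℝ} {y : Fin n → ℝ}
    (hy : ∀ s ∈ Set.Icc (t - S.τ) t, coordAbs V (x s) ≤ y) :
    S.theta x t ≤ V.map (fun z => ‖z‖) *ᵥ y :=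
  vmax_le (Set.nonempty_Icc.2 (sub_le_self t S.τ_nonneg)) fun s hs =>
    (abs_le_mulVec_coordAbs hV (x s)).trans
      (mulVec_mono_of_nonneg (A := V.map fun z => ‖z‖) (fun i l => norm_nonneg (V i l)) (hy s hs))

namespace IsTrajectory

variable {σ : ℝ → Fin N} {w : (i : Fin N) → ℝ → Fin (S.k i) → ℝ} {x : ℝ → Fin n → ℝ}

theorem coordAbs_le_vmax (hx : S.IsTrajectory σ w x) (V : Matrix (Fin n) (Fin n) ℂ) {t : ℝ}
    (ht : t ∈ Set.Icc (-S.τ) 0) :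
    coordAbs V (x t) ≤ vmax (Set.Icc (-S.τ) 0) fun t => coordAbs V (x t) := fun j =>
  le_vmax (f := fun t => coordAbs V (x t)) (isCompact_Icc.bddAbove_image
    ((continuous_apply j).comp_continuousOn ((lipschitzWith_coordAbs V).continuous.comp_continuousOn
      (hx.continuousOn.mono Set.Icc_subset_Ici_self)))) ht

theorem absolutelyContinuousOnInterval_coordAbs (hx : S.IsTrajectory σ w x)
    (V : Matrix (Fin n) (Fin n) ℂ) {t : ℝ} (ht : 0 ≤ t) :
    AbsolutelyContinuousOnInterval (fun s => coordAbs V (x s)) 0 t :=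
  absolutelyContinuousOnInterval_comp_of_lipschitzWith (lipschitzWith_coordAbs V)
    (hx.absolutelyContinuous t ht)

theorem coordAbs_input_le [NeZero N] (hx : S.IsTrajectory σ w x) (hS : ∀ i, CNI (S.δ i))
    (hV : IsUnit V.det) {t : ℝ} (ht : 0 ≤ t) {y : Fin n → ℝ}
    (hy : ∀ s ∈ Set.Icc (t - S.τ) t, coordAbs V (x s) ≤ y) (i : Fin N) :
    coordAbs V (S.H i *ᵥ w i t) ≤ S.psi V y := by
  have hθ := theta_le_mulVec hV hy
  have hθ_nonneg := S.theta_nonneg x t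
  exact S.coordAbs_le_psi V
    ((hx.bound t ht i).trans (hS i _ hθ_nonneg _ (hθ_nonneg.trans hθ) hθ))

theorem isDelaySubsolution [NeZero N] (hx : S.IsTrajectory σ w x) (hS : ∀ i, CNI (S.δ i))
    (hV : IsUnit V.det) {δ : (Fin n → ℝ) → Fin n → ℝ}
    (hδ_psi : ∀ y ∈ orthant n, S.psi V y ≤ δ y) :
    IsDelaySubsolution (S.Lam V) δ S.τ fun t => coordAbs V (x t) where
  nonneg t := cabs_nonneg _
  absolutelyContinuous t ht := hx.absolutelyContinuousOnInterval_coordAbs V ht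
  deriv_le := by
    have hdiff := ae_differentiableAt_of_forall_absolutelyContinuousOnInterval fun t ht =>
      hx.absolutelyContinuousOnInterval_coordAbs V ht
    filter_upwards [hx.ode, hdiff] with t hode hdiff ht y hy
    have hy_mem : y ∈ orthant n :=
      (cabs_nonneg _).trans (hy t ⟨sub_le_self t S.τ_nonneg, le_rfl⟩)
    have hz : HasDerivAt (fun s => coord V (x s))
        ((V⁻¹ * toC (S.A (σ t)) * V) *ᵥ coord V (x t) +
          coord V (S.H (σ t) *ᵥ w (σ t) t)) t := by
      rw [← coord_mulVec hV, ← map_add]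
      exact (coord V).hasFDerivAt.comp_hasDerivAt t (hode ht)
    calc deriv (fun s => coordAbs V (x s)) t
        ≤ metzlerPart (V⁻¹ * toC (S.A (σ t)) * V) *ᵥ coordAbs V (x t) +
          coordAbs V (S.H (σ t) *ᵥ w (σ t) t) := deriv_cabs_le_metzlerPart hz (hdiff ht)
      _ ≤ S.Lam V *ᵥ coordAbs V (x t) + δ y := add_le_add
        (mulVec_le_mulVec_of_entries_le (S.metzlerPart_le_lam V (σ t)) (cabs_nonneg _))
        ((hx.coordAbs_input_le hS hV ht hy (σ t)).trans (hδ_psi y hy_mem))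

end IsTrajectory

end System

end Switching

theorem mainTheorem5_general {n N : ℕ} [NeZero N] (S : Switching.System n N)
    (hS : ∀ i, Switching.CNI (S.δ i))
    (V : Matrix (Fin n) (Fin n) ℂ) (hV : IsUnit V)
    (hΛ : Switching.IsHurwitz (S.Lam V))
    (δ : (Fin n → ℝ) → Fin n → ℝ)
    (hδ_cont : ContinuousOn δ (Switching.orthant n))
    (hδ_cni : Switching.CNI δ)
    (hδ_psi : ∀ y ∈ Switching.orthant n, S.psi V y ≤ δ y)
    (σ : ℝ → Fin N) (w : (i : Fin N) → ℝ → Fin (S.k i) → ℝ) (x : ℝ → Fin n → ℝ)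
    (hx : S.IsTrajectory σ w x) (ξ β γ : Fin n → ℝ)
    (hξ : ∀ t ∈ Set.Icc (-S.τ) 0, Switching.coordAbs V (x t) ≤ ξ)
    (hβγ : Switching.Suitable (S.Lam V) δ ξ β γ) :
    ∃ b : Fin n → ℝ,
      Tendsto (fun k : ℕ => (Switching.T (S.Lam V) δ 0)^[k] β) atTop (𝓝 b) ∧
      ∀ j, IsBoundedUnder (· ≤ ·) atTop (fun t : ℝ => Switching.coordAbs V (x t) j) ∧
        limsup (fun t : ℝ => Switching.coordAbs V (x t) j) atTop ≤ b j := by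
  have hdet : IsUnit V.det := (Matrix.isUnit_iff_isUnit_det V).1 hV
  have hδ_nonneg : ∀ y ∈ Switching.orthant n, 0 ≤ δ y := fun y hy =>
    (S.psi_nonneg V y).trans (hδ_psi y hy)
  exact (hx.isDelaySubsolution hS hdet hδ_psi).limsup_le_of_suitable S.τ_nonneg
    (S.isMetzler_lam V) (fun _ => hΛ.neg_of_mem_spectrum) hδ_cont hδ_nonneg hδ_cni hβγ hξ

theorem mainTheorem5 {n N : ℕ} [NeZero N] (S : Switching.System n N)
    (hS : ∀ i, Switching.CNI (S.δ i))
    (V : Matrix (Fin n) (Fin n) ℂ) (hV : IsUnit V)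
    (hΛ : Switching.IsHurwitz (S.Lam V))
    (δ : (Fin n → ℝ) → Fin n → ℝ)
    (hδ_cont : ContinuousOn δ (Switching.orthant n))
    (hδ_nonneg : ∀ y ∈ Switching.orthant n, 0 ≤ δ y)
    (hδ_cni : Switching.CNI δ)
    (hδ_psi : ∀ y ∈ Switching.orthant n, S.psi V y ≤ δ y)
    (hsg : ∀ ξ ∈ Switching.orthant n, ∃ β γ, Switching.Suitable (S.Lam V) δ ξ β γ)
    (σ : ℝ → Fin N) (w : (i : Fin N) → ℝ → Fin (S.k i) → ℝ) (x : ℝ → Fin n → ℝ)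
    (hx : S.IsTrajectory σ w x) :
    (∃ β γ, Switching.Suitable (S.Lam V) δ
      (Switching.vmax (Set.Icc (-S.τ) 0) fun t => Switching.coordAbs V (x t)) β γ) ∧
    ∀ β γ, Switching.Suitable (S.Lam V) δ
      (Switching.vmax (Set.Icc (-S.τ) 0) fun t => Switching.coordAbs V (x t)) β γ →
      ∃ b : Fin n → ℝ,
        Tendsto (fun k : ℕ => (Switching.T (S.Lam V) δ 0)^[k] β) atTop (𝓝 b) ∧
        ∀ j, IsBoundedUnder (· ≤ ·) atTop (fun t : ℝ => Switching.coordAbs V (x t) j) ∧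
          limsup (fun t : ℝ => Switching.coordAbs V (x t) j) atTop ≤ b j := by
  exact ⟨hsg _ (Switching.vmax_nonneg fun _ _ => Switching.cabs_nonneg _), fun β γ =>
    mainTheorem5_general S hS V hV hΛ δ hδ_cont hδ_cni hδ_psi σ w x hx _ β γ
      fun _ => hx.coordAbs_le_vmax V⟩
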